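/- Let $E$ be a regular biordered set (in the sense of Nambooripad): a non-empty set with a partial binary operation satisfying the biordered set axioms, with quasi-orders $$e\,\omega^{l} f \iff ef=e,\qquad e\,\omega^{r} f\iff fe=e,\qquad \omega=\omega^{l}\cap\omega^{r},$$ and with all sandwich sets $S(e,f)$ non-empty. Here, for $e,f\in E$, $$M(e,f)=\{g\in E: g\,\omega^{l}e \text{ and } g\,\omega^{r}f\},$$ $$S(e,f)=\{h\in M(e,f):\ eg\,\omega^{r}\,eh \text{ and } gf\,\omega^{l}\,hf \text{ for all } g\in M(e,f)\}.$$ Suppose that (E1) there is an element $0\in E$ with $0\,\omega\, e$ for each $e\in E$; and (E2) there is a map $e\mapsto e'$ from $E$ to $E$ such that for all $e,f\in E$: (i) $e''=e$; (ii) $f\,\omega^{l}e$ if and only if $e'\,\omega^{r}f'$; (iii) $f\,\omega^{l}e'$ if and only if $M(f,e)=\{0\}$. Let $\mathcal L=\omega^{l}\cap(\omega^{l})^{-1}$, let $\mathcal L(e)$ be the $\mathcal L$-class of $e$, and order the set $E/\mathcal L$ of $\mathcal L$-classes by $\mathcal L(e)\le\mathcal L(f)\iff e\,\omega^{l}f$.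 Then $E/\mathcal L$ is a lattice with least and greatest elements and, for each $e\in E$, the classes $\mathcal L(e)$ and $\mathcal L(e')$ are complements of each other in it: $\mathcal L(e)\wedge\mathcal L(e')$ is the least element and $\mathcal L(e)\vee\mathcal L(e')$ is the greatest element of $E/\mathcal L$. -/

import Mathlib

/-!
Biordered sets.  A partial binary operation on `E` is a function `p : E → E → Option E`;
the product `e f` is defined when `p e f ≠ none`, and `p e f = some g` says that it is
defined and equal to `g`.
-/

namespace Biorder

variable {E : Type*}

/-- `e ω^l f`: the product `e f` is defined and equals `e`. -/
def LeL (p : E → E → Option E) (e f : E) : Prop := p e f = some e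

/-- `e ω^r f`: the product `f e` is defined and equals `e`. -/
def LeR (p : E → E → Option E) (e f : E) : Prop := p f e = some e

/-- `ω = ω^l ∩ ω^r`. -/
def Le (p : E → E → Option E) (e f : E) : Prop := LeL p e f ∧ LeR p e f

/-- Green's relation `L = ω^l ∩ (ω^l)⁻¹`. -/
def RelL (p : E → E → Option E) (e f : E) : Prop := LeL p e f ∧ LeL p f e

/-- Green's relation `R = ω^r ∩ (ω^r)⁻¹`. -/
def RelR (p : E → E → Option E) (e f : E) : Prop := LeR p e f ∧ LeR p f e

/-- `M(e, f) = ω^l(e) ∩ ω^r(f)`. -/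
def MSet (p : E → E → Option E) (e f : E) : Set E := {g | LeL p g e ∧ LeR p g f}

/-- The relation `g ≼ h` on `M(e, f)`: `eg ω^r eh` and `gf ω^l hf`
(for `g, h ∈ M(e, f)` the four products are defined in every biordered set). -/
def SandwichLe (p : E → E → Option E) (e f g h : E) : Prop :=
  (∃ a b, p e g = some a ∧ p e h = some b ∧ LeR p a b) ∧
  (∃ a b, p g f = some a ∧ p h f = some b ∧ LeL p a b)

/-- The sandwich set `S(e, f)`. -/
def Sandwich (p : E → E → Option E) (e f : E) : Set E :=
  {h | h ∈ MSet p e f ∧ ∀ g ∈ MSet p e f, SandwichLe p e f g h}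

/-- Nambooripad's axioms for a biordered set, one from each dual pair. The dual axioms are
these axioms for the opposite operation `flip p`; passing to `flip p` interchanges `ω^l` with
`ω^r`, `L` with `R`, `M(e, f)` with `M(f, e)` and `S(e, f)` with `S(f, e)`. -/
structure Axioms (p : E → E → Option E) : Prop where
  /-- `ω^r` is reflexive. -/
  refl : ∀ e, LeR p e e
  /-- `ω^r` is transitive. -/
  trans : ∀ e f g, LeR p e f → LeR p f g → LeR p e g
  /-- The domain of the operation is `(ω^l ∪ ω^r) ∪ (ω^l ∪ ω^r)⁻¹`. -/
  dom : ∀ e f, (∃ g, p e f = some g) ↔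
    ((LeL p e f ∨ LeR p e f) ∨ (LeL p f e ∨ LeR p f e))
  /-- `f ∈ ω^r(e)` implies `f R fe ω e`. -/
  B21 : ∀ e f, LeR p f e → ∃ a, p f e = some a ∧ RelR p f a ∧ Le p a e
  /-- `g ω^l f` and `f, g ∈ ω^r(e)` imply `ge ω^l fe`. -/
  B22 : ∀ e f g, LeL p g f → LeR p f e → LeR p g e →
    ∀ a b, p f e = some a → p g e = some b → LeL p b a
  /-- `g ω^r f ω^r e` implies `gf = (ge)f`. -/
  B31 : ∀ e f g, LeR p g f → LeR p f e → ∀ b, p g e = some b → p g f = p b f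
  /-- `g ω^l f` and `f, g ∈ ω^r(e)` imply `(fg)e = (fe)(ge)`. -/
  B32 : ∀ e f g, LeL p g f → LeR p f e → LeR p g e →
    ∀ a b c, p f e = some a → p g e = some b → p f g = some c → p c e = p a b
  /-- `f, g ∈ ω^r(e)` implies `S(f, g) e = S(fe, ge)`. -/
  B4 : ∀ e f g, LeR p f e → LeR p g e → ∀ a b, p f e = some a → p g e = some b →
    {k | ∃ h ∈ Sandwich p f g, p h e = some k} = Sandwich p a b

end Biorder

/-- A biordered set: a non-empty set with a partial binary operation `op` satisfying
Nambooripad's axioms and their duals. -/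
class BiorderedSet (E : Type*) where
  op : E → E → Option E
  nonempty : Nonempty E
  axs : Biorder.Axioms op
  dual_axs : Biorder.Axioms (flip op)

namespace BiorderedSet

variable {E : Type*} [BiorderedSet E]

/-- `e ω^l f`. -/
def LeL (e f : E) : Prop := Biorder.LeL op e f

/-- `e ω^r f`. -/
def LeR (e f : E) : Prop := Biorder.LeR op e f

/-- `e ω f`. -/
def Le (e f : E) : Prop := Biorder.Le op e f

/-- `M(e, f) = ω^l(e) ∩ ω^r(f)`. -/
def MSet (e f : E) : Set E := Biorder.MSet op e f

/-- The sandwich set `S(e, f)`. -/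
def Sandwich (e f : E) : Set E := Biorder.Sandwich op e f

variable (E) in
/-- A biordered set is regular if all its sandwich sets are non-empty. -/
def IsRegular : Prop := ∀ e f : E, (Sandwich e f).Nonempty

theorem LeL.refl (e : E) : LeL e e := dual_axs.refl e

theorem LeL.trans {e f g : E} (h : LeL e f) (k : LeL f g) : LeL e g :=
  dual_axs.trans e f g h k

variable (E) in
/-- The equivalence relation `L = ω^l ∩ (ω^l)⁻¹`. -/
def lSetoid : Setoid E where
  r e f := LeL e f ∧ LeL f e
  iseqv :=
    { refl := fun e => ⟨LeL.refl e, LeL.refl e⟩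
      symm := fun h => ⟨h.2, h.1⟩
      trans := fun h k => ⟨h.1.trans k.1, k.2.trans h.2⟩ }

variable (E) in
/-- The set `E/L` of `L`-classes. -/
def LQuot : Type _ := Quotient (lSetoid E)

/-- The class `L(e)` of `e`. -/
def lClass (e : E) : LQuot E := Quotient.mk (lSetoid E) e

/-- `E/L` is partially ordered by `L(e) ≤ L(f)` if and only if `e ω^l f`. -/
instance : PartialOrder (LQuot E) where
  le := Quotient.lift₂ (fun e f : E => LeL e f) (fun _ _ _ _ h k => propext
    ⟨fun t => h.2.trans (t.trans k.1), fun t => h.1.trans (t.trans k.2)⟩)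
  le_refl x := Quotient.inductionOn x LeL.refl
  le_trans x y z := Quotient.inductionOn₃ x y z fun _ _ _ h k => LeL.trans h k
  le_antisymm x y := Quotient.inductionOn₂ x y fun _ _ h k => Quotient.sound ⟨h, k⟩

theorem lClass_le_lClass {e f : E} : lClass e ≤ lClass f ↔ LeL e f := Iff.rfl

end BiorderedSet

/-- The partially ordered set `P` is a lattice with a least and a greatest element. -/
def IsBoundedLatticeOrder (P : Type*) [PartialOrder P] : Prop :=
  (∀ x y : P, (∃ s, IsLUB {x, y} s) ∧ ∃ m, IsGLB {x, y} m) ∧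
    (∃ b : P, IsBot b) ∧ ∃ t : P, IsTop t

/-- `x` and `y` are complements of each other: their meet exists and is the least element,
and their join exists and is the greatest element. -/
def AreComplements {P : Type*} [PartialOrder P] (x y : P) : Prop :=
  (∃ b, IsBot b ∧ IsGLB {x, y} b) ∧ ∃ t, IsTop t ∧ IsLUB {x, y} t

namespace Biorder

variable {E : Type*} {p : E → E → Option E}

/-! Write e' for `ann e`. By (iii), x ω^l f means M(x, f') = {0}. The meet of e and f is built by
two sandwich elements: h ∈ S(e, f') gives k = eh, the ω^r-largest left translate by e of M(e, f'),
and m ∈ S(k', e) gives the meet q = me (`exists_meet`). Axiom B4 lifts elements back through these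
translations (`exists_mem_mset_mul_eq`). The hypotheses are self-dual, so ω^r has meets too, and e ↦
e' turns these into joins for ω^l. -/

theorem Axioms.mul_right (A : Axioms p) {e f : E} (h : LeR p f e) :
    ∃ a, p f e = some a ∧ LeR p f a ∧ LeR p a f ∧ LeL p a e ∧ LeR p a e := by
  obtain ⟨a, h1, ⟨h2, h3⟩, h4, h5⟩ := A.B21 e f h
  exact ⟨a, h1, h2, h3, h4, h5⟩

theorem Axioms.mul_left (D : Axioms (flip p)) {e f : E} (h : LeL p f e) :
    ∃ a, p e f = some a ∧ LeL p f a ∧ LeL p a f ∧ LeR p a e ∧ LeL p a e :=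
  Axioms.mul_right D h

theorem mem_sandwich_flip {e f h : E} (hh : h ∈ Sandwich p e f) :
    h ∈ Sandwich (flip p) f e :=
  ⟨⟨hh.1.2, hh.1.1⟩, fun g hg => ⟨(hh.2 g ⟨hg.2, hg.1⟩).2, (hh.2 g ⟨hg.2, hg.1⟩).1⟩⟩

/-- If `b ω^l a`, then `b` lies in `S(a, b)`. -/
theorem right_mem_sandwich (A : Axioms p) (D : Axioms (flip p)) {a b : E} (h : LeL p b a) :
    b ∈ Sandwich p a b := by
  refine ⟨⟨h, A.refl b⟩, fun x hx => ⟨?_, ?_⟩⟩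
  · obtain ⟨u, hu, -⟩ := D.mul_left hx.1
    obtain ⟨v, hv, -⟩ := D.mul_left h
    exact ⟨u, v, hu, hv, D.B22 a b x hx.2 h hx.1 v u hv hu⟩
  · obtain ⟨u, hu, -, -, hub, -⟩ := A.mul_right hx.2
    exact ⟨u, b, hu, A.refl b, hub⟩

/-- If `f, g ∈ ω^r(e)` and `ge ω^l fe`, then `ge = he` for some `h ∈ M(f, g)`. -/
theorem exists_mem_mset_mul_eq (A : Axioms p) (D : Axioms (flip p)) {e f g a b : E}
    (hf : LeR p f e) (hg : LeR p g e) (ha : p f e = some a) (hb : p g e = some b)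
    (h : LeL p b a) : ∃ k, LeL p k f ∧ LeR p k g ∧ p k e = some b := by
  have hmem := right_mem_sandwich A D h
  -- B4 reads S(fe, ge) = S(f, g)e, so its member ge comes from an element of S(f, g).
  rw [← A.B4 e f g hf hg a b ha hb] at hmem
  obtain ⟨k, hk, hke⟩ := hmem
  exact ⟨k, hk.1.1, hk.1.2, hke⟩

theorem eq_of_leL {zero g : E} (hzero : ∀ e, Le p zero e) (h : LeL p g zero) : g = zero :=
  Option.some.inj (h.symm.trans (hzero g).2)

theorem mset_eq_singleton {zero e f : E} (hzero : ∀ e, Le p zero e)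
    (h : ∀ g, LeL p g e → LeR p g f → g = zero) : MSet p e f = {zero} :=
  Set.eq_singleton_iff_unique_mem.2
    ⟨⟨(hzero e).1, (hzero f).2⟩, fun g hg => h g hg.1 hg.2⟩

theorem eq_zero_of_mset {zero e f g : E} (h : MSet p e f = {zero})
    (h1 : LeL p g e) (h2 : LeR p g f) : g = zero :=
  (Set.eq_singleton_iff_unique_mem.1 h).2 g ⟨h1, h2⟩

/-- In a regular biordered set with annihilators, any two elements have a greatest common
lower bound for `ω^l`. -/
theorem exists_meet (A : Axioms p) (D : Axioms (flip p))
    (hreg : ∀ e f, (Sandwich p e f).Nonempty) {zero : E} (hzero : ∀ e, Le p zero e)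
    {ann : E → E} (hann_ann : ∀ e, ann (ann e) = e)
    (hann_mset : ∀ e f, LeL p f (ann e) ↔ MSet p f e = {zero}) (e f : E) :
    ∃ m, LeL p m e ∧ LeL p m f ∧ ∀ x, LeL p x e → LeL p x f → LeL p x m := by
  obtain ⟨h, ⟨hhe, hhf⟩, hmax⟩ := hreg e (ann f)
  obtain ⟨k, hk, hhk, hkh, hker, hkel⟩ := D.mul_left hhe
  obtain ⟨m, ⟨hmk, hme⟩, mmax⟩ := hreg (ann k) e
  obtain ⟨q, hq, hmq, hqm, hqel, hqer⟩ := A.mul_right hme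
  have hf : ∀ x, LeL p x f ↔ MSet p x (ann f) = {zero} := fun x => by
    rw [← hann_mset, hann_ann]
  refine ⟨q, hqel, (hf q).2 (mset_eq_singleton hzero fun g hgq hgf => ?_), fun x hxe hxf => ?_⟩
  -- Here n = eg L g satisfies n ω^r k and n = ne ω^l me; its lift c lies in M(m, k), which is {0}
  -- since m ω^l k'.
  · have hge : LeL p g e := D.trans g q e hgq hqel
    obtain ⟨⟨n, k', hn, hk', hnk⟩, -⟩ := hmax g ⟨hge, hgf⟩
    obtain rfl : k = k' := Option.some.inj (hk.symm.trans hk')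
    obtain ⟨n', hn', hgn, hng, hner, hnel⟩ := D.mul_left hge
    obtain rfl : n = n' := Option.some.inj (hn.symm.trans hn')
    obtain ⟨c, hcm, hcn, hce⟩ :=
      exists_mem_mset_mul_eq A D hme hner hq hnel (D.trans n g q hng hgq)
    obtain rfl : c = zero :=
      eq_zero_of_mset ((hann_mset k m).1 hmk) hcm (A.trans c n k hcn hnk)
    obtain rfl : c = n := Option.some.inj ((hzero e).1.symm.trans hce)
    exact eq_of_leL hzero hgn
  · have hxk : LeL p x (ann k) := by
      refine (hann_mset k x).2 (mset_eq_singleton hzero fun g hgx hgk => ?_)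
      have hge : LeL p g e := D.trans g x e hgx hxe
      have hger : LeR p g e := A.trans g k e hgk hker
      -- The dual lift: g = eg ω^r eh comes from some c ∈ M(x, f') = {0} with ec = g.
      obtain ⟨c, hch, hcg, hce⟩ :=
        exists_mem_mset_mul_eq (p := flip p) D A hhe hge hk hger hgk
      obtain rfl : c = zero := eq_zero_of_mset ((hf x).1 hxf)
        (D.trans c g x hcg hgx) (A.trans c h (ann f) hch hhf)
      exact (Option.some.inj ((hzero e).2.symm.trans hce)).symm
    -- Unlike x, the L-equivalent y = ex is also below e in ω^r, so y ∈ M(k', e) and maximality of m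
    -- applies.
    obtain ⟨y, hy, hxy, hyx, hyer, hyel⟩ := D.mul_left hxe
    obtain ⟨-, u, v, hu, hv, huv⟩ := mmax y ⟨D.trans y x _ hyx hxk, hyer⟩
    obtain rfl : y = u := Option.some.inj (hyel.symm.trans hu)
    obtain rfl : q = v := Option.some.inj (hq.symm.trans hv)
    exact D.trans x y q hxy huv

/-- The product ex is L-related to x and lies in M(x, e) = {0}. -/
theorem eq_zero_of_leL_ann (D : Axioms (flip p)) {zero : E} (hzero : ∀ e, Le p zero e)
    {ann : E → E} (hann_mset : ∀ e f, LeL p f (ann e) ↔ MSet p f e = {zero}) {e x : E}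
    (h : LeL p x e) (h' : LeL p x (ann e)) : x = zero := by
  obtain ⟨y, -, hxy, hyx, hyer, -⟩ := D.mul_left h
  obtain rfl := eq_zero_of_mset ((hann_mset e x).1 h') hyx hyer
  exact eq_of_leL hzero hxy

end Biorder

open BiorderedSet in
theorem corollary3p5 {E : Type*} [BiorderedSet E] (hreg : IsRegular E)
    (zero : E) (hzero : ∀ e : E, Le zero e)
    (ann : E → E)
    (hann_ann : ∀ e : E, ann (ann e) = e)
    (hann_le : ∀ e f : E, LeL f e ↔ LeR (ann e) (ann f))
    (hann_mset : ∀ e f : E, LeL f (ann e) ↔ MSet f e = {zero}) :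
    IsBoundedLatticeOrder (LQuot E) ∧
      ∀ e : E, AreComplements (lClass e) (lClass (ann e)) := by
  have A : Biorder.Axioms (op : E → E → Option E) := axs
  have D : Biorder.Axioms (flip (op : E → E → Option E)) := dual_axs
  have hzero' : ∀ e : E, Biorder.Le (flip op) zero e := fun e => ⟨(hzero e).2, (hzero e).1⟩
  have hreg' : ∀ e f : E, (Biorder.Sandwich (flip op) e f).Nonempty := fun e f =>
    (hreg f e).imp fun _ => Biorder.mem_sandwich_flip
  -- (iii) is self-dual: by (i) and (ii), f ω^r e' iff e ω^l f', and flipping swaps M(f, e) with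
  -- M(e, f).
  have hann_mset' : ∀ e f : E,
      Biorder.LeL (flip op) f (ann e) ↔ Biorder.MSet (flip op) f e = {zero} := fun e f => by
    have hswap : Biorder.MSet (flip op) f e = MSet e f := Set.ext fun _ => and_comm
    rw [hswap, ← hann_mset, hann_le, hann_ann]
    rfl
  have hann_le' : ∀ e f : E, LeL (ann e) f ↔ LeR (ann f) e := fun e f => by
    rw [hann_le, hann_ann]
  have hbot : IsBot (lClass zero) := fun x => Quotient.inductionOn x fun e => (hzero e).1
  have htop : IsTop (lClass (ann zero)) := fun x => Quotient.inductionOn x fun e =>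
    (hann_mset zero e).2 (Biorder.mset_eq_singleton hzero fun _ _ hg =>
      Biorder.eq_of_leL hzero' hg)
  refine ⟨⟨fun x y => ?_, ⟨_, hbot⟩, ⟨_, htop⟩⟩, fun e => ⟨⟨_, hbot, ?_⟩, ⟨_, htop, ?_⟩⟩⟩
  · refine Quotient.inductionOn₂ x y fun e f => ⟨?_, ?_⟩
    · obtain ⟨m, hme, hmf, hmax⟩ := Biorder.exists_meet (p := flip op) D A hreg' hzero'
        hann_ann hann_mset' (ann e) (ann f)
      refine ⟨lClass (ann m), ?_, fun z => Quotient.inductionOn z fun x hx => ?_⟩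
      · rintro _ (rfl | rfl)
        · exact (hann_le (ann m) e).2 (by rw [hann_ann]; exact hme)
        · exact (hann_le (ann m) f).2 (by rw [hann_ann]; exact hmf)
      · exact (hann_le' m x).2 (hmax (ann x)
          ((hann_le x e).1 (hx (Or.inl rfl))) ((hann_le x f).1 (hx (Or.inr rfl))))
    · obtain ⟨m, hme, hmf, hmax⟩ := Biorder.exists_meet A D hreg hzero hann_ann hann_mset e f
      refine ⟨lClass m, ?_, fun z => Quotient.inductionOn z fun x hx => ?_⟩
      · rintro _ (rfl | rfl)
        exacts [hme, hmf]
      · exact hmax x (hx (Or.inl rfl)) (hx (Or.inr rfl))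
  · refine ⟨fun z _ => hbot z, fun z => Quotient.inductionOn z fun x hx => ?_⟩
    obtain rfl : x = zero := Biorder.eq_zero_of_leL_ann D hzero hann_mset
      (hx (Or.inl rfl)) (hx (Or.inr rfl))
    exact le_rfl
  · refine ⟨fun z _ => htop z, fun z => Quotient.inductionOn z fun x hx => ?_⟩
    have h1 : LeR (ann x) (ann e) := (hann_le x e).1 (hx (Or.inl rfl))
    have h2 : LeR (ann x) e := (hann_le' e x).1 (hx (Or.inr rfl))
    have h : ann x = zero := Biorder.eq_zero_of_leL_ann (p := flip op) A hzero' hann_mset' h2 h1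
    rw [← h, hann_ann]
    exact le_rfl
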